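/- For $k\ge 1$ let $\Omega_k$ be the set of pairs $(\boldsymbol\lambda,\boldsymbol\mu)\in\mathbb R^k\times\mathbb R^k$ with $\lambda_j\ge 0$ for all $j$, $\sum_j\lambda_j=1$ and $\mu_1<\dots<\mu_k$, and let $\mathcal S$ be the set of all probability distributions on $\mathbb R$ that are symmetric about zero. For $(\boldsymbol\lambda,\boldsymbol\mu)\in\Omega_k$ let $\Delta_k(\boldsymbol\lambda,\boldsymbol\mu)=\sum_{j}\lambda_j\delta_{\mu_j}$ be the distribution with mass $\lambda_j$ at $\mu_j$. A probability distribution $F$ on $\mathbb R$ is called $k$-identifiable if there is exactly one triple $(\boldsymbol\lambda,\boldsymbol\mu,G)\in\Omega_k\times\mathcal S$ with $F=G\star\Delta_k(\boldsymbol\lambda,\boldsymbol\mu)$, where $\star$ denotes convolution. Let $$\Omega_k^*=\{(\boldsymbol\lambda,\boldsymbol\mu)\in\Omega_k : G\star\Delta_k(\boldsymbol\lambda,\boldsymbol\mu)\text{ is }k\text{-identifiable for all }G\in\mathcal S\}.$$ **Corollary 1.** Let $(\boldsymbol\lambda,\boldsymbol\mu)\in\Omega_3$. If $\lambda_1\lambda_2\lambda_3\neq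 0$ and $(\mu_2-\mu_1)/(\mu_3-\mu_2)\notin\{\tfrac13,\tfrac12,1,2,3\}$, then $(\boldsymbol\lambda,\boldsymbol\mu)\in\Omega_3^*$. Consequently, three-component location mixtures of a symmetric distribution are almost always $3$-identifiable: the set $\Omega_3\setminus\Omega_3^*$, viewed as a subset of $\mathbb R^5$ through the coordinates $(\lambda_1,\lambda_2,\mu_1,\mu_2,\mu_3)$ (with $\lambda_3=1-\lambda_1-\lambda_2$), has Lebesgue measure zero. -/

import Mathlib

open MeasureTheory

noncomputable section

namespace SymMix

/-- The parameter space `Ω_k`: pairs `(λ, μ)` with `λ_j ≥ 0`, `∑ λ_j = 1`, `μ_1 < ⋯ < μ_k`. -/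
def Omega (k : ℕ) : Set ((Fin k → ℝ) × (Fin k → ℝ)) :=
  {θ | (∀ j, 0 ≤ θ.1 j) ∧ ∑ j, θ.1 j = 1 ∧ StrictMono θ.2}

/-- The set `𝒮` of probability distributions on `ℝ` that are symmetric about zero, that is,
invariant under the reflection `x ↦ -x`. -/
def ZeroSymmetric : Set (Measure ℝ) :=
  {G | IsProbabilityMeasure G ∧ G.map (fun x => -x) = G}

/-- The finite distribution `Δ_k(λ, μ)`, with mass `λ_j` at the point `μ_j`. -/
def Delta {k : ℕ} (θ : (Fin k → ℝ) × (Fin k → ℝ)) : Measure ℝ :=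
  ∑ j, ENNReal.ofReal (θ.1 j) • Measure.dirac (θ.2 j)

/-- The map `φ_k`, sending `(λ, μ, G)` to the location mixture `G ⋆ Δ_k(λ, μ)`. -/
def mixture {k : ℕ} (θ : (Fin k → ℝ) × (Fin k → ℝ)) (G : Measure ℝ) : Measure ℝ :=
  Measure.conv G (Delta θ)

/-- The inverse image of `F` under `φ_k`, as a subset of `Ω_k × 𝒮`. -/
def fiber (k : ℕ) (F : Measure ℝ) : Set (((Fin k → ℝ) × (Fin k → ℝ)) × Measure ℝ) :=
  {p | p.1 ∈ Omega k ∧ p.2 ∈ ZeroSymmetric ∧ mixture p.1 p.2 = F}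

/-- `F` is `k`-identifiable: it is represented by exactly one element of `Ω_k × 𝒮`. -/
def IsIdentifiable (k : ℕ) (F : Measure ℝ) : Prop :=
  ∃ p, fiber k F = {p}

/-- `Ω_k^*`: the parameters in `Ω_k` whose mixtures are `k`-identifiable for all `G ∈ 𝒮`. -/
def OmegaStar (k : ℕ) : Set ((Fin k → ℝ) × (Fin k → ℝ)) :=
  {θ | θ ∈ Omega k ∧ ∀ G ∈ ZeroSymmetric, IsIdentifiable k (mixture θ G)}

/-- The parameter with `k + 1` components and coordinates `(λ_1, …, λ_k, μ_1, …, μ_{k+1})` in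
`ℝ^(2k+1)`; the last weight is `1 - λ_1 - ⋯ - λ_k`. -/
def ofCoords {k : ℕ} (x : (Fin k → ℝ) × (Fin (k + 1) → ℝ)) :
    (Fin (k + 1) → ℝ) × (Fin (k + 1) → ℝ) :=
  (Fin.snoc (α := fun _ => ℝ) x.1 (1 - ∑ j, x.1 j), x.2)

end SymMix

end

/-!
Suppose `G ⋆ P = H ⋆ Q` with `G`, `H` symmetric, and let `X ∼ P` and `Y ∼ Q` be independent.
Convolving with the reflection of `Q` shows that the convolution of `G` with the law of `X - Y` is
symmetric. Since the characteristic function of `G` does not vanish near `0` and that of a finite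
distribution is analytic, `G` can be cancelled: `X - Y` is symmetric. Comparing its extreme values
shows that the supports of `P` and `Q` have the same midpoint. Centred there, they are `{-a, s, a}`
and `{-b, t, b}`, and comparing the masses of `±x` for the largest values `x` of `X - Y` forces
`a = b` and `s = t`, unless `s ∈ {0, ±a/2, ±a/3}`: these are the five excluded ratios. The same
comparison rules out that `Q` has fewer than three atoms. Finally `Q` is cancelled in
`G ⋆ Q = H ⋆ Q`, since the zeros of its characteristic function are isolated.
-/

open Topology

namespace SymMix

/-- The odd function supported on `{x, -x}` with value `1` at `x`, for `x ≠ 0`. Its integral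
is the difference of the masses at `x` and `-x`. -/
noncomputable def oddIndicator (x u : ℝ) : ℝ :=
  (if u = x then 1 else 0) - (if u = -x then 1 else 0)

lemma odd_oddIndicator (x : ℝ) : (oddIndicator x).Odd := fun u ↦ by
  simp [oddIndicator, neg_eq_iff_eq_neg]

lemma oddIndicator_self {x : ℝ} (hx : x ≠ 0) : oddIndicator x x = 1 := by
  simp [oddIndicator, self_eq_neg, hx]

lemma oddIndicator_of_ne {x u : ℝ} (h : u ≠ x) (h' : u ≠ -x) : oddIndicator x u = 0 := by
  simp [oddIndicator, h, h']

/-- For independent `X ∼ ∑ pᵢ δ_{mᵢ}` and `Y ∼ ∑ qⱼ δ_{nⱼ}`, symmetry of the law of `X - Y` about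
zero, tested against odd functions. -/
def Balanced {ι κ : Type*} [Fintype ι] [Fintype κ] (p m : ι → ℝ) (q n : κ → ℝ) : Prop :=
  ∀ f : ℝ → ℝ, f.Odd → ∑ i, ∑ j, p i * q j * f (m i - n j) = 0

namespace Balanced

section General

variable {ι κ : Type*} [Fintype ι] [Fintype κ] {p m : ι → ℝ} {q n : κ → ℝ}

lemma swap (h : Balanced p m q n) : Balanced q n p m := fun f hf ↦ by
  rw [Finset.sum_comm, ← neg_eq_zero, ← h f hf]
  simp only [← Finset.sum_neg_distrib]
  refine Fintype.sum_congr _ _ fun i ↦ Fintype.sum_congr _ _ fun j ↦ ?_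
  rw [← neg_sub (m i), hf]
  ring

lemma neg (h : Balanced p m q n) : Balanced p (-m) q (-n) := fun f hf ↦ by
  rw [← h.swap f hf, Finset.sum_comm]
  refine Fintype.sum_congr _ _ fun j ↦ Fintype.sum_congr _ _ fun i ↦ ?_
  rw [Pi.neg_apply, Pi.neg_apply, neg_sub_neg, mul_comm (p i)]

lemma reindex {ι' κ' : Type*} [Fintype ι'] [Fintype κ'] (h : Balanced p m q n) (e : ι' ≃ ι)
    (e' : κ' ≃ κ) : Balanced (p ∘ e) (m ∘ e) (q ∘ e') (n ∘ e') := fun f hf ↦ by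
  rw [← h f hf, ← e.sum_comp]
  exact Fintype.sum_congr _ _ fun i ↦ e'.sum_comp fun j ↦ p (e i) * q j * f (m (e i) - n j)

lemma sub_const (h : Balanced p m q n) (c : ℝ) :
    Balanced p (fun i ↦ m i - c) q (fun j ↦ n j - c) := fun f hf ↦ by
  simpa only [sub_sub_sub_cancel_right] using h f hf

lemma congr_right {κ' : Type*} [Fintype κ'] {q' n' : κ' → ℝ} (h : Balanced p m q n)
    (heq : ∀ f : ℝ → ℝ, ∑ j, q' j * f (n' j) = ∑ j, q j * f (n j)) : Balanced p m q' n' :=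
  fun f hf ↦ by
    rw [← h f hf]
    refine Fintype.sum_congr _ _ fun i ↦ ?_
    simp only [mul_assoc, ← Finset.mul_sum, heq fun y ↦ f (m i - y)]

lemma exists_sub_eq_neg (h : Balanced p m q n) (hp : ∀ i, 0 < p i) (hq : ∀ j, 0 < q j) (i : ι)
    (j : κ) : ∃ i' j', m i' - n j' = -(m i - n j) := by
  by_contra! hne
  have hnonneg (i' : ι) (j' : κ) :
      0 ≤ p i' * q j' * oddIndicator (m i - n j) (m i' - n j') := by
    have := (mul_pos (hp i') (hq j')).le
    simp only [oddIndicator, if_neg (hne i' j'), sub_zero]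
    positivity
  have hpos : 0 < p i * q j * oddIndicator (m i - n j) (m i - n j) := by
    have := mul_pos (hp i) (hq j)
    simpa only [oddIndicator, if_pos, if_neg (hne i j), sub_zero, mul_one]
  refine (Finset.sum_pos' (fun i' _ ↦ Finset.sum_nonneg fun j' _ ↦ hnonneg i' j')
    ⟨i, Finset.mem_univ i, ?_⟩).ne' (h _ (odd_oddIndicator _))
  exact Finset.sum_pos' (fun j' _ ↦ hnonneg i j') ⟨j, Finset.mem_univ j, hpos⟩

lemma extremes_add_le (h : Balanced p m q n) (hp : ∀ i, 0 < p i) (hq : ∀ j, 0 < q j) {i₀ i₁ : ι}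
    {j₀ j₁ : κ} (hm : ∀ i, m i₀ ≤ m i) (hn : ∀ j, n j ≤ n j₁) : m i₀ + m i₁ ≤ n j₀ + n j₁ := by
  obtain ⟨i, j, hij⟩ := h.exists_sub_eq_neg hp hq i₁ j₀
  linarith [hm i, hn j]

end General

section Centred

variable {p q : Fin 3 → ℝ} {a b s t α β : ℝ}

lemma two_point_identity (h : Balanced p ![-a, s, a] ![α, β] ![-b, b]) {f : ℝ → ℝ} (hf : f.Odd) :
    (p 2 * α - p 0 * β) * f (a + b) + (p 2 * β - p 0 * α) * f (a - b)
      + p 1 * (α * f (b + s) - β * f (b - s)) = 0 := by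
  have key := h f hf
  simp only [Fin.sum_univ_three, Fin.sum_univ_two, Matrix.cons_val] at key
  rw [show -a - -b = -(a - b) by ring, show -a - b = -(a + b) by ring,
    show s - b = -(b - s) by ring, show s - -b = b + s by ring, sub_neg_eq_add] at key
  simp only [hf _] at key
  linear_combination key

lemma three_point_identity (h : Balanced p ![-a, s, a] q ![-b, t, b]) {f : ℝ → ℝ} (hf : f.Odd) :
    (p 2 * q 0 - p 0 * q 2) * f (a + b) + (p 2 * q 2 - p 0 * q 0) * f (a - b)
      + q 1 * (p 2 * f (a - t) - p 0 * f (a + t)) + p 1 * (q 0 * f (b + s) - q 2 * f (b - s))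
      + p 1 * q 1 * f (s - t) = 0 := by
  have key := h f hf
  simp only [Fin.sum_univ_three, Matrix.cons_val] at key
  rw [show -a - -b = -(a - b) by ring, show -a - b = -(a + b) by ring,
    show -a - t = -(a + t) by ring, show s - b = -(b - s) by ring,
    show s - -b = b + s by ring, sub_neg_eq_add] at key
  simp only [hf _] at key
  linear_combination key

lemma reflect_two_point (h : Balanced p ![-a, s, a] ![α, β] ![-b, b]) :
    Balanced (p ∘ Fin.rev) ![-a, -s, a] ![β, α] ![-b, b] := by
  convert h.neg.reindex Fin.revPerm Fin.revPerm using 1 <;> ext i <;> fin_cases i <;> simp [Fin.rev]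

lemma reflect_three_point (h : Balanced p ![-a, s, a] q ![-b, t, b]) :
    Balanced (p ∘ Fin.rev) ![-a, -s, a] (q ∘ Fin.rev) ![-b, -t, b] := by
  convert h.neg.reindex Fin.revPerm Fin.revPerm using 1 <;> ext i <;> fin_cases i <;> simp [Fin.rev]

lemma eq_div_three_of_two_point (h : Balanced p ![-a, s, a] ![α, β] ![-b, b]) (hp : 0 < p 1)
    (hα : 0 < α) (hβ : 0 < β) (hb : 0 ≤ b) (hs : 0 < s) (hsa : s < a) : s = a / 3 := by
  have hpα := mul_pos hp hα
  have hpβ := mul_pos hp hβ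
  have hab : b + s = a - b := by
    by_contra hne
    have key := h.two_point_identity (odd_oddIndicator (b + s))
    rcases hb.eq_or_lt with rfl | hb
    · rw [zero_add, zero_sub, odd_oddIndicator] at key
      simp (disch := grind) only [oddIndicator_self, oddIndicator_of_ne] at key
      linarith
    · simp (disch := grind) only [oddIndicator_self, oddIndicator_of_ne] at key
      linarith
  suffices b = s by linarith
  by_contra hne
  have key := h.two_point_identity (odd_oddIndicator (b - s))
  simp (disch := grind) only [oddIndicator_self, oddIndicator_of_ne] at key
  linarith

lemma outer_weights_mul_eq (h : Balanced p ![-a, s, a] q ![-b, t, b]) (hs : |s| < a)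
    (ht : |t| < b) : p 2 * q 0 = p 0 * q 2 := by
  have key := h.three_point_identity (odd_oddIndicator (a + b))
  simp (disch := grind) only [oddIndicator_self, oddIndicator_of_ne] at key
  linarith

lemma add_abs_le_add_abs (h : Balanced p ![-a, s, a] q ![-b, t, b]) (hp : 0 < p 1)
    (hq : ∀ i, 0 < q i) (hs : |s| < a) (ht : |t| < b) (hs₀ : s ≠ 0) : b + |s| ≤ a + |t| := by
  have hq₀ := mul_pos hp (hq 0)
  have hq₂ := mul_pos hp (hq 2)
  -- Below `a + b`, whose coefficient vanishes, `b + |s|` would be the largest absolute difference,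
  -- attained by a single pair of atoms.
  by_contra! hlt
  have key := h.three_point_identity (odd_oddIndicator (b + |s|))
  rw [sub_eq_zero.2 (h.outer_weights_mul_eq hs ht)] at key
  rcases hs₀.lt_or_gt with hs' | hs'
  · rw [abs_of_neg hs', ← sub_eq_add_neg] at key
    simp (disch := grind) only [oddIndicator_self, oddIndicator_of_ne] at key
    linarith
  · rw [abs_of_pos hs'] at key
    simp (disch := grind) only [oddIndicator_self, oddIndicator_of_ne] at key
    linarith

lemma add_eq_of_center_zero (h : Balanced p ![-a, s, a] q ![-b, 0, b]) (hp : ∀ i, 0 < p i)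
    (hq : ∀ i, 0 < q i) (hs : 0 < s) (hsa : s < a) (hb : 0 < b) : b + s = a := by
  have hs' : |s| < a := by rwa [abs_of_pos hs]
  have hb' : |(0 : ℝ)| < b := by rwa [abs_zero]
  have htop := h.outer_weights_mul_eq hs' hb'
  have hle := h.add_abs_le_add_abs (hp 1) hq hs' hb' hs.ne'
  rw [abs_of_pos hs, abs_zero, add_zero] at hle
  by_contra hne
  have hp₀₂ : p 2 = p 0 := by
    have key := h.three_point_identity (odd_oddIndicator a)
    simp (disch := grind) only [sub_zero, add_zero, oddIndicator_self, oddIndicator_of_ne] at key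
    nlinarith [hq 1]
  have hq₀₂ : q 0 = q 2 := mul_left_cancel₀ (hp 0).ne' (by rw [← htop, hp₀₂])
  have key := h.three_point_identity (odd_oddIndicator (b + s))
  rw [hp₀₂, hq₀₂, sub_self] at key
  simp (disch := grind) only [oddIndicator_self, oddIndicator_of_ne] at key
  linarith [mul_pos (hp 1) (hq 2)]

lemma eq_div_two_or_eq_div_three (h : Balanced p ![-a, s, a] q ![-b, 0, b]) (hp : ∀ i, 0 < p i)
    (hq : ∀ i, 0 < q i) (hs : 0 < s) (hsa : s < a) (hb : 0 < b) : s = a / 2 ∨ s = a / 3 := by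
  obtain rfl := h.add_eq_of_center_zero hp hq hs hsa hb
  by_contra! hne
  have hpq := mul_pos (hp 1) (hq 2)
  have key := h.three_point_identity (odd_oddIndicator (b - s))
  simp (disch := grind) only [oddIndicator_self, oddIndicator_of_ne] at key
  linarith

lemma center_nonneg (h : Balanced p ![-a, s, a] q ![-b, t, b]) (hp : ∀ i, 0 < p i)
    (hq : ∀ i, 0 < q i) (hs : 0 < s) (hsa : s < a) (ht : |t| < b) : 0 ≤ t := by
  have hs' : |s| < a := by rwa [abs_of_pos hs]
  have hpq := mul_pos (hp 1) (hq 0)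
  have hpq' := mul_pos (hp 2) (hq 1)
  by_contra! ht₀
  have hab := (h.add_abs_le_add_abs (hp 1) hq hs' ht hs.ne').antisymm
    (h.swap.add_abs_le_add_abs (hq 1) hp ht hs' ht₀.ne)
  rw [abs_of_pos hs, abs_of_neg ht₀, ← sub_eq_add_neg] at hab
  have key := h.three_point_identity (odd_oddIndicator (b + s))
  rw [sub_eq_zero.2 (h.outer_weights_mul_eq hs' ht), hab] at key
  simp (disch := grind) only [oddIndicator_self, oddIndicator_of_ne] at key
  linarith

lemma half_width_le (h : Balanced p ![-a, s, a] q ![-b, t, b]) (hp : 0 < p 2) (hq : 0 < q 1)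
    (hs : 0 < s) (hsa : s < a) (ht : 0 < t) (htb : t < b) (hab : b + s = a + t) : a ≤ b := by
  have hpq := mul_pos hp hq
  by_contra! hlt
  have key := h.three_point_identity (odd_oddIndicator (a - t))
  simp (disch := grind) only [oddIndicator_self, oddIndicator_of_ne] at key
  linarith

lemma centred_eq_of_pos (h : Balanced p ![-a, s, a] q ![-b, t, b]) (hp : ∀ i, 0 < p i)
    (hq : ∀ i, 0 < q i) (hs : 0 < s) (hsa : s < a) (ht : |t| < b) (hs₂ : s ≠ a / 2)
    (hs₃ : s ≠ a / 3) : a = b ∧ s = t := by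
  have hs' : |s| < a := by rwa [abs_of_pos hs]
  rcases (h.center_nonneg hp hq hs hsa ht).eq_or_lt with rfl | ht₀
  · rw [abs_zero] at ht
    exact ((h.eq_div_two_or_eq_div_three hp hq hs hsa ht).elim hs₂ hs₃).elim
  · have hab := (h.add_abs_le_add_abs (hp 1) hq hs' ht hs.ne').antisymm
      (h.swap.add_abs_le_add_abs (hq 1) hp ht hs' ht₀.ne')
    rw [abs_of_pos ht₀] at ht hab
    rw [abs_of_pos hs] at hab
    have hwidth : a = b := (h.half_width_le (hp 2) (hq 1) hs hsa ht₀ ht hab).antisymm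
      (h.swap.half_width_le (hq 2) (hp 1) ht₀ ht hs hsa hab.symm)
    exact ⟨hwidth, by linarith⟩

lemma centred_eq (h : Balanced p ![-a, s, a] q ![-b, t, b]) (hp : ∀ i, 0 < p i)
    (hq : ∀ i, 0 < q i) (hs : |s| < a) (ht : |t| < b) (hs₀ : s ≠ 0) (hs₂ : |s| ≠ a / 2)
    (hs₃ : |s| ≠ a / 3) : a = b ∧ s = t := by
  rcases hs₀.lt_or_gt with hneg | hpos
  · rw [abs_of_neg hneg] at hs hs₂ hs₃
    obtain ⟨hab, hst⟩ := h.reflect_three_point.centred_eq_of_pos (fun _ ↦ hp _) (fun _ ↦ hq _)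
      (neg_pos.2 hneg) hs (by rwa [abs_neg]) hs₂ hs₃
    exact ⟨hab, neg_injective hst⟩
  · rw [abs_of_pos hpos] at hs hs₂ hs₃
    exact h.centred_eq_of_pos hp hq hpos hs ht hs₂ hs₃

lemma abs_eq_div_three_of_two_point (h : Balanced p ![-a, s, a] ![α, β] ![-b, b]) (hp : 0 < p 1)
    (hα : 0 < α) (hβ : 0 < β) (hb : 0 ≤ b) (hs : |s| < a) (hs₀ : s ≠ 0) : |s| = a / 3 := by
  rcases hs₀.lt_or_gt with hneg | hpos
  · rw [abs_of_neg hneg] at hs ⊢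
    exact h.reflect_two_point.eq_div_three_of_two_point hp hβ hα hb (neg_pos.2 hneg) hs
  · rw [abs_of_pos hpos] at hs ⊢
    exact h.eq_div_three_of_two_point hp hα hβ hb hpos hs

lemma inner_weights_mul_eq (h : Balanced p ![-a, s, a] q ![-a, s, a]) (hs : |s| < a) (hs₀ : s ≠ 0) :
    p 1 * q 0 = p 0 * q 1 := by
  have key := h.three_point_identity (odd_oddIndicator (a + s))
  simp (disch := grind) only [oddIndicator_self, oddIndicator_of_ne] at key
  linarith

end Centred

end Balanced

lemma sub_midpoint (m : Fin 3 → ℝ) : (fun i ↦ m i - (m 0 + m 2) / 2)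
    = ![-((m 2 - m 0) / 2), m 1 - (m 0 + m 2) / 2, (m 2 - m 0) / 2] := by
  ext i
  fin_cases i <;> simp <;> ring

lemma abs_sub_midpoint_lt {m : Fin 3 → ℝ} (hm : StrictMono m) :
    |m 1 - (m 0 + m 2) / 2| < (m 2 - m 0) / 2 := by
  have h₀₁ : m 0 < m 1 := hm (by decide)
  have h₁₂ : m 1 < m 2 := hm (by decide)
  rw [abs_lt]
  constructor <;> linarith

lemma sub_midpoint_ne_of_ratio {m : Fin 3 → ℝ} (hm : StrictMono m)
    (hr : (m 1 - m 0) / (m 2 - m 1) ∉ ({1 / 3, 1 / 2, 1, 2, 3} : Set ℝ)) :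
    m 1 - (m 0 + m 2) / 2 ≠ 0 ∧ |m 1 - (m 0 + m 2) / 2| ≠ (m 2 - m 0) / 2 / 2 ∧
      |m 1 - (m 0 + m 2) / 2| ≠ (m 2 - m 0) / 2 / 3 := by
  have hgap : 0 < m 2 - m 1 := sub_pos.2 (hm (by decide))
  simp only [Set.mem_insert_iff, Set.mem_singleton_iff, div_eq_iff hgap.ne', not_or] at hr
  obtain ⟨h₁, h₂, h₃, h₄, h₅⟩ := hr
  refine ⟨fun h ↦ h₃ (by linarith), fun h ↦ ?_, fun h ↦ ?_⟩
  · rcases eq_or_eq_neg_of_abs_eq h with h | h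
    · exact h₅ (by linarith)
    · exact h₁ (by linarith)
  · rcases eq_or_eq_neg_of_abs_eq h with h | h
    · exact h₄ (by linarith)
    · exact h₂ (by linarith)

lemma eq_of_proportional {ι : Type*} [Fintype ι] {p q : ι → ℝ} (hp : ∑ i, p i = 1)
    (hq : ∑ i, q i = 1) {j : ι} (hj : p j ≠ 0) (h : ∀ i, p i * q j = p j * q i) : q = p := by
  have hqj : q j = p j := by
    simpa only [← Finset.sum_mul, ← Finset.mul_sum, hp, hq, one_mul, mul_one]
      using Fintype.sum_congr _ _ h
  exact funext fun i ↦ mul_left_cancel₀ hj (by rw [← h, hqj, mul_comm])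

lemma exists_pos_two_atoms {α β u v : ℝ} (hα : 0 ≤ α) (hβ : 0 ≤ β) (hαβ : 0 < α + β)
    (huv : u ≤ v) : ∃ α' β' u' v' : ℝ, 0 < α' ∧ 0 < β' ∧ u' ≤ v' ∧
      ∀ f : ℝ → ℝ, α' * f u' + β' * f v' = α * f u + β * f v := by
  -- A single atom is split into two equal atoms at the same point.
  rcases hα.eq_or_lt with rfl | hα
  · exact ⟨β / 2, β / 2, v, v, by linarith, by linarith, le_rfl, fun f ↦ by ring⟩
  rcases hβ.eq_or_lt with rfl | hβ
  · exact ⟨α / 2, α / 2, u, u, by linarith, by linarith, le_rfl, fun f ↦ by ring⟩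
  exact ⟨α, β, u, v, hα, hβ, huv, fun f ↦ rfl⟩

lemma Omega.exists_two_atoms_of_eq_zero {q n : Fin 3 → ℝ} (hqn : (q, n) ∈ Omega 3) {j : Fin 3}
    (hj : q j = 0) : ∃ α β u v : ℝ, 0 < α ∧ 0 < β ∧ u ≤ v ∧
      ∀ f : ℝ → ℝ, α * f u + β * f v = ∑ i, q i * f (n i) := by
  obtain ⟨hq, hsum, hn⟩ := hqn
  dsimp only at hq hsum hn
  rw [Fin.sum_univ_succAbove _ j, hj, zero_add, Fin.sum_univ_two] at hsum
  obtain ⟨α, β, u, v, hα, hβ, huv, h⟩ := exists_pos_two_atoms (hq (j.succAbove 0))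
    (hq (j.succAbove 1)) (hsum ▸ one_pos)
    (hn.monotone (j.strictMono_succAbove.monotone zero_le_one))
  refine ⟨α, β, u, v, hα, hβ, huv, fun f ↦ ?_⟩
  rw [h, Fin.sum_univ_succAbove _ j, hj, zero_mul, zero_add, Fin.sum_univ_two]

namespace Balanced

variable {p m q n : Fin 3 → ℝ}

lemma not_balanced_two_point {α β u v : ℝ} (hp : ∀ i, 0 < p i) (hm : StrictMono m)
    (hr : (m 1 - m 0) / (m 2 - m 1) ∉ ({1 / 3, 1 / 2, 1, 2, 3} : Set ℝ)) (hα : 0 < α)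
    (hβ : 0 < β) (huv : u ≤ v) : ¬ Balanced p m ![α, β] ![u, v] := by
  intro h
  have hpos : ∀ j, 0 < ![α, β] j := Fin.forall_fin_two.2 ⟨hα, hβ⟩
  have hbot (i) : m 0 ≤ m i := hm.monotone (Fin.zero_le i)
  have htop (i) : m i ≤ m 2 := hm.monotone (Fin.le_last i)
  have hmid : m 0 + m 2 = u + v :=
    (h.extremes_add_le hp hpos (j₀ := 0) (j₁ := 1) hbot
      (Fin.forall_fin_two.2 ⟨huv, le_rfl⟩)).antisymm
    (h.swap.extremes_add_le hpos hp (i₀ := 0) (i₁ := 1) (Fin.forall_fin_two.2 ⟨le_rfl, huv⟩) htop)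
  have hcentred := h.sub_const ((m 0 + m 2) / 2)
  have huv' : (fun j ↦ ![u, v] j - (m 0 + m 2) / 2) = ![-((v - u) / 2), (v - u) / 2] := by
    rw [hmid]
    ext j
    fin_cases j <;> simp <;> ring
  rw [sub_midpoint, huv'] at hcentred
  obtain ⟨hs₀, -, hs₃⟩ := sub_midpoint_ne_of_ratio hm hr
  exact hs₃ (hcentred.abs_eq_div_three_of_two_point (hp 1) hα hβ (by linarith)
    (abs_sub_midpoint_lt hm) hs₀)

lemma endpoints_add_le (h : Balanced p m q n) (hp : ∀ i, 0 < p i) (hq : ∀ i, 0 < q i)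
    (hm : StrictMono m) (hn : StrictMono n) : m 0 + m 2 ≤ n 0 + n 2 :=
  h.extremes_add_le hp hq (fun i ↦ hm.monotone (Fin.zero_le i)) fun j ↦ hn.monotone (Fin.le_last j)

lemma eq_of_pos (h : Balanced p m q n) (hp : ∀ i, 0 < p i) (hq : ∀ i, 0 < q i)
    (hp₁ : ∑ i, p i = 1) (hq₁ : ∑ i, q i = 1) (hm : StrictMono m) (hn : StrictMono n)
    (hr : (m 1 - m 0) / (m 2 - m 1) ∉ ({1 / 3, 1 / 2, 1, 2, 3} : Set ℝ)) : q = p ∧ n = m := by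
  have hmid : m 0 + m 2 = n 0 + n 2 :=
    (h.endpoints_add_le hp hq hm hn).antisymm (h.swap.endpoints_add_le hq hp hn hm)
  obtain ⟨hs₀, hs₂, hs₃⟩ := sub_midpoint_ne_of_ratio hm hr
  have hs := abs_sub_midpoint_lt hm
  have hcentred := h.sub_const ((m 0 + m 2) / 2)
  rw [sub_midpoint, hmid, sub_midpoint, ← hmid] at hcentred
  have ht : |n 1 - (m 0 + m 2) / 2| < (n 2 - n 0) / 2 := hmid ▸ abs_sub_midpoint_lt hn
  obtain ⟨hwidth, hcenter⟩ := hcentred.centred_eq hp hq hs ht hs₀ hs₂ hs₃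
  rw [← hwidth, ← hcenter] at hcentred
  refine ⟨eq_of_proportional hp₁ hq₁ (hp 0).ne' fun i ↦ ?_, funext fun i ↦ ?_⟩
  · fin_cases i
    exacts [rfl, hcentred.inner_weights_mul_eq hs hs₀, hcentred.outer_weights_mul_eq hs hs]
  · fin_cases i <;> dsimp only [Fin.reduceFinMk, Fin.isValue] <;> linarith

theorem eq_of_mem_omega (h : Balanced p m q n) (hpm : (p, m) ∈ Omega 3) (hqn : (q, n) ∈ Omega 3)
    (hp : ∀ i, 0 < p i)
    (hr : (m 1 - m 0) / (m 2 - m 1) ∉ ({1 / 3, 1 / 2, 1, 2, 3} : Set ℝ)) : q = p ∧ n = m := by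
  by_cases hq : ∀ i, 0 < q i
  · exact h.eq_of_pos hp hq hpm.2.1 hqn.2.1 hpm.2.2 hqn.2.2 hr
  obtain ⟨j, hj⟩ := not_forall.1 hq
  obtain ⟨α, β, u, v, hα, hβ, huv, hatoms⟩ :=
    Omega.exists_two_atoms_of_eq_zero hqn ((not_lt.1 hj).antisymm (hqn.1 j))
  have htwo : Balanced p m ![α, β] ![u, v] := h.congr_right fun f ↦ by
    rw [Fin.sum_univ_two]
    exact hatoms f
  exact (not_balanced_two_point hp hpm.2.2 hr hα hβ huv htwo).elim

end Balanced

/-- The finite measure `∑ wᵢ δ_{uᵢ}`, for nonnegative weights `w`. The points `uᵢ` may coincide, so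
that convolutions of such measures are again of this form, indexed by the product. -/
noncomputable def pointMasses {ι : Type*} [Fintype ι] (w u : ι → ℝ) : Measure ℝ :=
  ∑ i, ENNReal.ofReal (w i) • Measure.dirac (u i)

section PointMasses

variable {ι κ : Type*} [Fintype ι] [Fintype κ]

instance (w u : ι → ℝ) : IsFiniteMeasure (pointMasses w u) :=
  ⟨by simp [pointMasses, Measure.finsetSum_apply, ENNReal.sum_lt_top]⟩

lemma integral_pointMasses {E : Type*} [NormedAddCommGroup E] [NormedSpace ℝ E] [CompleteSpace E]
    {w : ι → ℝ} (hw : ∀ i, 0 ≤ w i) (u : ι → ℝ) (f : ℝ → E) :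
    ∫ x, f x ∂(pointMasses w u) = ∑ i, w i • f (u i) := by
  rw [pointMasses, integral_finsetSum_measure
    fun i _ ↦ (integrable_dirac (by simp)).smul_measure ENNReal.ofReal_ne_top]
  refine Fintype.sum_congr _ _ fun i ↦ ?_
  rw [integral_smul_measure, integral_dirac, ENNReal.toReal_ofReal (hw i)]

lemma charFun_pointMasses {w : ι → ℝ} (hw : ∀ i, 0 ≤ w i) (u : ι → ℝ) (t : ℝ) :
    charFun (pointMasses w u) t = ∑ i, (w i : ℂ) * Complex.exp (t * u i * Complex.I) := by
  simp only [charFun_apply_real, integral_pointMasses hw, Complex.real_smul]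

lemma analyticOnNhd_charFun_pointMasses {w : ι → ℝ} (hw : ∀ i, 0 ≤ w i) (u : ι → ℝ) :
    AnalyticOnNhd ℝ (charFun (pointMasses w u)) Set.univ := by
  intro t _
  have hcast : AnalyticAt ℝ (fun t : ℝ ↦ (t : ℂ)) t := Complex.ofRealCLM.analyticAt t
  have hexp (z : ℂ) : AnalyticAt ℝ Complex.exp z :=
    (Complex.differentiable_exp.analyticAt z).restrictScalars
  rw [funext (charFun_pointMasses hw u)]
  fun_prop

lemma conv_pointMasses {w : ι → ℝ} {w' : κ → ℝ} (hw : ∀ i, 0 ≤ w i) (hw' : ∀ j, 0 ≤ w' j)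
    (u : ι → ℝ) (u' : κ → ℝ) : (pointMasses w u).conv (pointMasses w' u')
      = pointMasses (fun ij : ι × κ ↦ w ij.1 * w' ij.2) fun ij ↦ u ij.1 + u' ij.2 := by
  refine Measure.ext_of_charFun (funext fun t ↦ ?_)
  rw [charFun_conv, charFun_pointMasses hw, charFun_pointMasses hw',
    charFun_pointMasses fun ij : ι × κ ↦ mul_nonneg (hw ij.1) (hw' ij.2), Fintype.sum_mul_sum,
    ← Fintype.sum_prod_type']
  refine Fintype.sum_congr _ _ fun ij ↦ ?_
  push_cast
  rw [mul_mul_mul_comm, ← Complex.exp_add, mul_add, add_mul]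

lemma neg_pointMasses (w u : ι → ℝ) : (pointMasses w u).neg = pointMasses w (-u) := by
  simp only [pointMasses, Measure.neg, Measure.map_finset_sum measurable_neg.aemeasurable,
    Measure.map_smul, Measure.map_dirac' measurable_neg, Pi.neg_apply]

end PointMasses

lemma charFun_zero_ne_zero (ρ : Measure ℝ) [IsFiniteMeasure ρ] [NeZero ρ] : charFun ρ 0 ≠ 0 := by
  simp [charFun_zero, measureReal_univ_ne_zero]

lemma eq_of_conv_eq_conv_left {ρ μ ν : Measure ℝ} [IsFiniteMeasure ρ] [NeZero ρ]
    [IsFiniteMeasure μ] [IsFiniteMeasure ν] (hμ : AnalyticOnNhd ℝ (charFun μ) Set.univ)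
    (hν : AnalyticOnNhd ℝ (charFun ν) Set.univ) (h : ρ.conv μ = ρ.conv ν) : μ = ν := by
  refine Measure.ext_of_charFun (hμ.eq_of_eventuallyEq (z₀ := 0) hν ?_)
  have hcont : Continuous (charFun ρ) := by fun_prop
  filter_upwards [hcont.continuousAt.eventually_ne (charFun_zero_ne_zero ρ)] with t ht
  exact mul_left_cancel₀ ht (by rw [← charFun_conv, h, charFun_conv])

lemma eq_of_conv_eq_conv_right {ρ μ ν : Measure ℝ} [IsFiniteMeasure ρ] [NeZero ρ]
    [IsFiniteMeasure μ] [IsFiniteMeasure ν] (hρ : AnalyticOnNhd ℝ (charFun ρ) Set.univ)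
    (h : μ.conv ρ = ν.conv ρ) : μ = ν := by
  refine Measure.ext_of_charFun (funext fun t ↦ ?_)
  have hne : ∀ᶠ s in 𝓝[≠] t, charFun ρ s ≠ 0 :=
    (hρ t trivial).eventually_eq_zero_or_eventually_ne_zero.resolve_left fun hzero ↦
      charFun_zero_ne_zero ρ (hρ.eqOn_zero_of_preconnected_of_eventuallyEq_zero
        isPreconnected_univ trivial hzero trivial)
  have hpunctured : charFun μ =ᶠ[𝓝[≠] t] charFun ν := by
    filter_upwards [hne] with s hs
    exact mul_right_cancel₀ hs (by rw [← charFun_conv, h, charFun_conv])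
  have hμ : Continuous (charFun μ) := by fun_prop
  have hν : Continuous (charFun ν) := by fun_prop
  exact ((hμ.continuousAt.eventuallyEq_nhds_iff_eventuallyEq_nhdsNE
    hν.continuousAt).1 hpunctured).eq_of_nhds

section Reflection

variable {M : Type*} [AddCommGroup M] [MeasurableSpace M] [MeasurableAdd₂ M] [MeasurableNeg M]

lemma neg_conv (μ ν : Measure M) [SFinite μ] [SFinite ν] : (μ.conv ν).neg = μ.neg.conv ν.neg :=
  Measure.map_conv_addMonoidHom (L := negAddMonoidHom) measurable_neg

lemma neg_conv_conv_neg_eq {G H P Q : Measure M} [SFinite H] [SFinite P] [SFinite Q]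
    [H.IsNegInvariant] (h : G.conv P = H.conv Q) :
    (G.conv (P.conv Q.neg)).neg = G.conv (P.conv Q.neg) := by
  calc (G.conv (P.conv Q.neg)).neg
      = (H.conv (Q.conv Q.neg)).neg := by rw [← Measure.conv_assoc, h, Measure.conv_assoc]
    _ = H.conv (Q.conv Q.neg) := by
      rw [neg_conv, neg_conv, Measure.neg_neg, Measure.neg_eq_self, Measure.conv_comm Q]
    _ = G.conv (P.conv Q.neg) := by rw [← Measure.conv_assoc, ← h, Measure.conv_assoc]

end Reflection

section Mixture

variable {k l : ℕ} {θ : (Fin k → ℝ) × (Fin k → ℝ)} {η : (Fin l → ℝ) × (Fin l → ℝ)}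
  {G H : Measure ℝ}

theorem balanced_of_mixture_eq (hθ : θ ∈ Omega k) (hη : η ∈ Omega l) (hG : G ∈ ZeroSymmetric)
    (hH : H ∈ ZeroSymmetric) (h : mixture θ G = mixture η H) : Balanced θ.1 θ.2 η.1 η.2 := by
  have := hG.1
  have := hH.1
  have : G.IsNegInvariant := ⟨hG.2⟩
  have : H.IsNegInvariant := ⟨hH.2⟩
  have hw (ij : Fin k × Fin l) : 0 ≤ θ.1 ij.1 * η.1 ij.2 := mul_nonneg (hθ.1 _) (hη.1 _)
  have hsymm := neg_conv_conv_neg_eq (P := pointMasses θ.1 θ.2) (Q := pointMasses η.1 η.2) h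
  rw [neg_pointMasses, conv_pointMasses hθ.1 hη.1, neg_conv, neg_pointMasses,
    Measure.neg_eq_self] at hsymm
  have hcancel := eq_of_conv_eq_conv_left (analyticOnNhd_charFun_pointMasses hw _)
    (analyticOnNhd_charFun_pointMasses hw _) hsymm
  intro f hf
  have hodd := congrArg (fun μ : Measure ℝ ↦ ∫ x, f x ∂μ) hcancel
  simp only [integral_pointMasses hw, Pi.neg_apply, hf _, ← sub_eq_add_neg, smul_eq_mul, mul_neg,
    Finset.sum_neg_distrib, neg_eq_self] at hodd
  rwa [← Fintype.sum_prod_type']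

theorem zeroSymmetric_eq_of_mixture_eq (hθ : θ ∈ Omega k) (hG : G ∈ ZeroSymmetric)
    (hH : H ∈ ZeroSymmetric) (h : mixture θ G = mixture θ H) : G = H := by
  have := hG.1
  have := hH.1
  have : NeZero (pointMasses θ.1 θ.2) := ⟨fun hzero ↦ by
    have hmass := integral_pointMasses hθ.1 θ.2 fun _ ↦ (1 : ℝ)
    simp [hzero, hθ.2.1] at hmass⟩
  exact eq_of_conv_eq_conv_right (analyticOnNhd_charFun_pointMasses hθ.1 θ.2) h

end Mixture

theorem mem_omegaStar_three {l m : Fin 3 → ℝ} (h : (l, m) ∈ Omega 3) (hl : l 0 * l 1 * l 2 ≠ 0)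
    (hr : (m 1 - m 0) / (m 2 - m 1) ∉ ({1 / 3, 1 / 2, 1, 2, 3} : Set ℝ)) :
    (l, m) ∈ OmegaStar 3 := by
  have hpos (i) : 0 < l i := (h.1 i).lt_of_ne' fun hzero ↦ hl <| by
    fin_cases i <;> simp_all
  refine ⟨h, fun G hG ↦ ⟨((l, m), G), Set.eq_singleton_iff_unique_mem.2 ⟨⟨h, hG, rfl⟩, ?_⟩⟩⟩
  rintro ⟨⟨q, n⟩, H⟩ ⟨hqn, hH, heq⟩
  obtain ⟨rfl, rfl⟩ :=
    (balanced_of_mixture_eq h hqn hG hH heq.symm).eq_of_mem_omega h hqn hpos hr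
  exact congrArg (Prod.mk _) (zeroSymmetric_eq_of_mixture_eq h hH hG heq)

lemma ae_linearMap_ne {E : Type*} [NormedAddCommGroup E] [NormedSpace ℝ E] [MeasurableSpace E]
    [BorelSpace E] [FiniteDimensional ℝ E] (μ : Measure E) [μ.IsAddHaarMeasure] {L : E →ₗ[ℝ] ℝ}
    (hL : L ≠ 0) (c : ℝ) : ∀ᵐ x ∂μ, L x ≠ c :=
  (ae_comp_linearMap_mem_iff L μ volume (LinearMap.surjective hL)
    (measurableSet_singleton c).compl).2 (Measure.ae_ne volume c)

lemma ae_coords_generic : ∀ᵐ x : (Fin 2 → ℝ) × (Fin 3 → ℝ),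
    x.1 0 ≠ 0 ∧ x.1 1 ≠ 0 ∧ x.1 0 + x.1 1 ≠ 1 ∧
      ∀ r ∈ ({1 / 3, 1 / 2, 1, 2, 3} : Set ℝ), x.2 1 - x.2 0 ≠ r * (x.2 2 - x.2 1) := by
  have : (volume : Measure ((Fin 2 → ℝ) × (Fin 3 → ℝ))).IsAddHaarMeasure :=
    Measure.prod.instIsAddHaarMeasure volume volume
  let weight (i : Fin 2) : ((Fin 2 → ℝ) × (Fin 3 → ℝ)) →ₗ[ℝ] ℝ := .proj i ∘ₗ .fst ℝ _ _
  let location (i : Fin 3) : ((Fin 2 → ℝ) × (Fin 3 → ℝ)) →ₗ[ℝ] ℝ := .proj i ∘ₗ .snd ℝ _ _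
  let gap (r : ℝ) := location 1 - location 0 - r • (location 2 - location 1)
  have hweight (i) : weight i ≠ 0 := fun h ↦ by
    simpa [weight] using LinearMap.congr_fun h (1, 0)
  have hsum : weight 0 + weight 1 ≠ 0 := fun h ↦ by
    simpa [weight] using LinearMap.congr_fun h (1, 0)
  have hgap (r) : gap r ≠ 0 := fun h ↦ by
    simpa [gap, location] using LinearMap.congr_fun h (0, ![1, 0, 0])
  have hratios : ({1 / 3, 1 / 2, 1, 2, 3} : Set ℝ).Countable := (Set.toFinite _).countable
  filter_upwards [ae_linearMap_ne volume (hweight 0) 0, ae_linearMap_ne volume (hweight 1) 0,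
    ae_linearMap_ne volume hsum 1,
    (ae_ball_iff hratios).2 fun r _ ↦ ae_linearMap_ne volume (hgap r) 0] with x h₀ h₁ h₂ hr
  exact ⟨h₀, h₁, h₂, fun r hmem h ↦ hr r hmem (sub_eq_zero.2 h)⟩

theorem volume_omega_diff_omegaStar_three :
    volume {x : (Fin 2 → ℝ) × (Fin 3 → ℝ) | ofCoords x ∈ Omega 3 \ OmegaStar 3} = 0 := by
  rw [measure_eq_zero_iff_ae_notMem]
  filter_upwards [ae_coords_generic] with x ⟨h₀, h₁, hsum, hratio⟩ ⟨hx, hx'⟩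
  refine hx' (mem_omegaStar_three hx (mul_ne_zero (mul_ne_zero h₀ h₁) fun h₂ ↦ hsum ?_) fun hr ↦ ?_)
  · replace h₂ : 1 - ∑ j, x.1 j = 0 := h₂
    rw [← Fin.sum_univ_two, eq_comm, ← sub_eq_zero, h₂]
  · have hgap : x.2 2 - x.2 1 ≠ 0 := (sub_pos.2 (hx.2.2 (by decide))).ne'
    exact hratio _ hr (div_mul_cancel₀ _ hgap).symm

end SymMix

theorem corollary1 :
    (∀ l m : Fin 3 → ℝ, (l, m) ∈ SymMix.Omega 3 →
      l 0 * l 1 * l 2 ≠ 0 →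
      (m 1 - m 0) / (m 2 - m 1) ∉ ({1 / 3, 1 / 2, 1, 2, 3} : Set ℝ) →
      (l, m) ∈ SymMix.OmegaStar 3) ∧
    volume {x : (Fin 2 → ℝ) × (Fin 3 → ℝ) |
      SymMix.ofCoords x ∈ SymMix.Omega 3 \ SymMix.OmegaStar 3} = 0 :=
  ⟨fun _ _ ↦ SymMix.mem_omegaStar_three, SymMix.volume_omega_diff_omegaStar_three⟩
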